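/- **Setting.** Consider $n$ qubits, with Pauli strings $\sigma\in\{I,\sigma_X,\sigma_Y,\sigma_Z\}^{\otimes n}$. For a Hermitian $2^n\times 2^n$ matrix $M$ write $M=\frac{\mathrm{Tr}(M)}{2^n}I+\boldsymbol w\cdot\boldsymbol\sigma_n$, where $\boldsymbol\sigma_n$ lists the Pauli strings other than $I^{\otimes n}$; $\boldsymbol w$ is the real vector with entries $\mathrm{Tr}(M\sigma)/2^n$. *Noise.* Let $q_X,q_Y,q_Z\ge 0$ with $q_X+q_Y+q_Z\le 1$, let $\mathcal P(\rho)=\sum_{i\in\{X,Y,Z\}}q_i\sigma_i\rho\sigma_i+(1-\sum_i q_i)\rho$ be the single-qubit Pauli channel, and let $q=\max\{|1-2q_Y-2q_Z|,\,|1-2q_X-2q_Z|,\,|1-2q_X-2q_Y|\}$ be its strength. *Circuit.* For $l\ge 1$ let $U_l(\theta_l)=\exp\{-i\sum_j(\theta_{lj}H_{lj}+R_{lj})\}$ (a finite sum) with Hermitian $H_{lj},R_{lj}$ and real parameters $\theta_{lj}$. Starting from a density matrix $\rho_0$ put $\rho_l=\mathcal P^{\otimes n}\big(U_l(\theta_l)\rho_{l-1}U_l(\theta_l)^\dagger\big)$;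 $\rho_L$ is the output of the noisy circuit of depth $L$. *Costs.* Let $O=\sum_i\lambda_i|i\rangle\langle i|$ be an eigendecomposition of an observable (an orthonormal eigenbasis $|i\rangle$, real $\lambda_i$), let $S$ be a set of indices $i$, identified with the subspace spanned by the $|i\rangle$, $i\in S$, and put $p_i=\langle i|\rho_L|i\rangle$, $O_1=\sum_{i\in S}\lambda_i|i\rangle\langle i|$, $O_2=\sum_{i\in S}|i\rangle\langle i|$, $k_a=\mathrm{Tr}(O_a)/2^n$, $O_a=k_aI+\boldsymbol w_a\cdot\boldsymbol\sigma_n$, $O_a'=O_a-k_aI$ ($a=1,2$). The truncated costs are $$C_1=\frac{\sum_{i\in S}\lambda_ip_i}{\sum_{i\in S}p_i},\qquad C_2=\frac{\mathrm{Tr}(\rho_LO_1')}{\mathrm{Tr}(\rho_LO_2')}.$$ **Theorem 3.1 (Mitigating gradient vanishing).** Let $\epsilon>0$ be small in the sense that $\sqrt2\,\epsilon^2\le q$, and let $L_0$ be the least integer $\ge 0$ with $q^{L_0}\sqrt{2^n-1}\,\|\boldsymbol w_2\|_2(1+\epsilon)\le\left|\frac{\mathrm{Tr}(O_2)}{2^n}\right|$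 (it is assumed to exist). Then for every depth $L>2L_0+1$, every parameter $\theta_{lm}$ with $1\le l\le L$, and every parameter point at which $\mathrm{Tr}(\rho_LO_2')\ne0$ (so that $C_2$ is defined there), $C_1$ and $C_2$ are differentiable in $\theta_{lm}$ and $$\left|\partial_{\theta_{lm}}C_2\right|\ \ge\ \frac{s}{q^{L+1}}\left|\partial_{\theta_{lm}}C_1\right|-1,$$ where $$s=\min\left\{\frac{\epsilon^2k_2^2}{(1+\epsilon)^2\sqrt{2^{n+1}-2}\,N_{lm}\|\boldsymbol\eta_{lm}\|_\infty\|\boldsymbol w_1k_2-\boldsymbol w_2k_1\|_2},\ \left(\frac{|k_2|}{q^{L_0}\sqrt{2^n-1}\,\|\boldsymbol w_2\|_2}-q^{L_0+1}\right)^2\right\},$$ $\boldsymbol\eta_{lm}$ is the vector of coefficients of $H_{lm}=\frac{\mathrm{Tr}(H_{lm})}{2^n}I+\boldsymbol\eta_{lm}\cdot\boldsymbol\sigma_n$, and $N_{lm}$ is the number of its non-zero entries. (If the first denominator is $0$, both gradients are $0$ and the value of $s$ is immaterial.) -/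

import Mathlib

open scoped Matrix ComplexOrder

noncomputable section

namespace NoisyVQA

/-- Labels of the `n`-qubit computational basis. -/
abbrev Bits (n : ℕ) : Type := Fin n → Fin 2

/-- Operators on `n` qubits, that is, on a Hilbert space of dimension `2 ^ n`. -/
abbrev Op (n : ℕ) : Type := Matrix (Bits n) (Bits n) ℂ

/-! ### Pauli strings and Pauli coefficients -/

/-- The single-qubit matrices `I, σ_X, σ_Y, σ_Z`, in this order. -/
def pauli : Fin 4 → Matrix (Fin 2) (Fin 2) ℂ :=
  ![1, !![0, 1; 1, 0], !![0, -Complex.I; Complex.I, 0], !![1, 0; 0, -1]]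

/-- The Pauli string `σ_{p 0} ⊗ ⋯ ⊗ σ_{p (n-1)}`, written in the computational basis. -/
def pauliString {n : ℕ} (p : Fin n → Fin 4) : Op n :=
  Matrix.of fun x y => ∏ k, pauli (p k) (x k) (y k)

/-- The Pauli strings other than the identity string. -/
abbrev NontrivialString (n : ℕ) : Type := {p : Fin n → Fin 4 // p ≠ 0}

/-- The identity coefficient `Tr(M) / 2 ^ n` of a Hermitian operator `M`. -/
def identityCoeff {n : ℕ} (M : Op n) : ℝ := M.trace.re / 2 ^ n

/-- The vector `w` with `M = (Tr(M) / 2 ^ n) I + w · σ` for a Hermitian operator `M`: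
`w_p = Tr(M σ_p) / 2 ^ n` for all Pauli strings `p` other than the identity string.
Its norm is the Euclidean norm. -/
def pauliVec {n : ℕ} (M : Op n) : EuclideanSpace ℝ (NontrivialString n) :=
  WithLp.toLp 2 fun p => (M * pauliString p.1).trace.re / 2 ^ n

/-- The maximum norm of a vector of Pauli coefficients. -/
def maxNorm {n : ℕ} (w : EuclideanSpace ℝ (NontrivialString n)) : ℝ := ‖WithLp.ofLp w‖

/-- The number of non-zero entries of a vector of Pauli coefficients. -/
def numNonzero {n : ℕ} (w : EuclideanSpace ℝ (NontrivialString n)) : ℕ :=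
  {p : NontrivialString n | w p ≠ 0}.ncard

/-! ### Local Pauli noise -/

/-- The error probabilities of a single-qubit Pauli channel. -/
structure PauliNoise where
  qX : ℝ
  qY : ℝ
  qZ : ℝ
  qX_nonneg : 0 ≤ qX
  qY_nonneg : 0 ≤ qY
  qZ_nonneg : 0 ≤ qZ
  sum_le_one : qX + qY + qZ ≤ 1

/-- The single-qubit Pauli channel
`ρ ↦ ∑_{i ∈ {X,Y,Z}} q_i σ_i ρ σ_i + (1 - ∑_i q_i) ρ`. -/
def PauliNoise.channel (ν : PauliNoise) (ρ : Matrix (Fin 2) (Fin 2) ℂ) :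
    Matrix (Fin 2) (Fin 2) ℂ :=
  (ν.qX : ℂ) • (pauli 1 * ρ * pauli 1) + (ν.qY : ℂ) • (pauli 2 * ρ * pauli 2)
    + (ν.qZ : ℂ) • (pauli 3 * ρ * pauli 3) + ((1 - (ν.qX + ν.qY + ν.qZ) : ℝ) : ℂ) • ρ

/-- The noise strength `q`: the largest absolute value of the three factors by which the
single-qubit channel multiplies `σ_X`, `σ_Y` and `σ_Z`. -/
def PauliNoise.strength (ν : PauliNoise) : ℝ :=
  max |1 - 2 * ν.qY - 2 * ν.qZ| (max |1 - 2 * ν.qX - 2 * ν.qZ| |1 - 2 * ν.qX - 2 * ν.qY|)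

/-- The `n`-th tensor power of a linear map `P` on single-qubit operators. On matrix units,
`|x⟩⟨y| = ⨂ₖ |xₖ⟩⟨yₖ|` is sent to `⨂ₖ P(|xₖ⟩⟨yₖ|)`, and this is extended linearly. -/
def tensorPower {n : ℕ} (P : Matrix (Fin 2) (Fin 2) ℂ → Matrix (Fin 2) (Fin 2) ℂ) (ρ : Op n) :
    Op n :=
  ∑ x : Bits n, ∑ y : Bits n,
    ρ x y • Matrix.of fun x' y' => ∏ k, P (Matrix.single (x k) (y k) 1) (x' k) (y' k)

/-! ### Noisy variational circuits -/

/-- A layered variational ansatz on `n` qubits. Layers are numbered from `0`; the circuit of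
depth `L` consists of the layers `0, …, L - 1`. -/
structure Ansatz (n : ℕ) where
  numParams : ℕ → ℕ
  H : (l : ℕ) → Fin (numParams l) → Op n
  R : (l : ℕ) → Fin (numParams l) → Op n
  H_hermitian : ∀ l j, (H l j).IsHermitian
  R_hermitian : ∀ l j, (R l j).IsHermitian

/-- The parameters `θ_{lj}` of an ansatz. -/
abbrev Ansatz.Params {n : ℕ} (A : Ansatz n) : Type := (l : ℕ) → Fin (A.numParams l) → ℝ

/-- The parameters `θ` with the entry `θ_{lm}` replaced by `t`. -/
def Ansatz.setParam {n : ℕ} (A : Ansatz n) (θ : A.Params) (l : ℕ) (m : Fin (A.numParams l))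
    (t : ℝ) : A.Params :=
  Function.update θ l (Function.update (θ l) m t)

/-- The unitary `U_l(θ_l) = exp(-i ∑_j (θ_{lj} H_{lj} + R_{lj}))` of layer `l`. -/
def Ansatz.layerUnitary {n : ℕ} (A : Ansatz n) (θ : A.Params) (l : ℕ) : Op n :=
  NormedSpace.exp (-Complex.I • ∑ j, ((θ l j : ℂ) • A.H l j + A.R l j))

/-- The output state of the noisy circuit of depth `L` on the input `ρ₀`: each layer applies its
unitary and then the Pauli channel on every qubit. -/
def Ansatz.noisyState {n : ℕ} (A : Ansatz n) (ν : PauliNoise) (ρ₀ : Op n) (θ : A.Params) :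
    ℕ → Op n
  | 0 => ρ₀
  | l + 1 => tensorPower ν.channel
      (A.layerUnitary θ l * A.noisyState ν ρ₀ θ l * (A.layerUnitary θ l)ᴴ)

/-- A density operator. -/
def IsDensity {n : ℕ} (ρ : Op n) : Prop := ρ.PosSemidef ∧ ρ.trace = 1

/-! ### Truncated observables and cost functions -/

/-- An eigendecomposition `O = ∑ᵢ λᵢ |i⟩⟨i|` of an observable on `n` qubits, together with a
subspace spanned by some of the eigenvectors `|i⟩`, given by the set `S` of their indices. -/
structure TruncatedObservable (n : ℕ) where
  eigenbasis : OrthonormalBasis (Bits n) ℂ (EuclideanSpace ℂ (Bits n))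
  eigenvalue : Bits n → ℝ
  S : Finset (Bits n)

namespace TruncatedObservable

variable {n : ℕ} (T : TruncatedObservable n)

/-- The projector `|i⟩⟨i|`. -/
def proj (i : Bits n) : Op n :=
  Matrix.vecMulVec (WithLp.ofLp (T.eigenbasis i)) (star (WithLp.ofLp (T.eigenbasis i)))

/-- `O₁ = ∑_{i ∈ S} λᵢ |i⟩⟨i|`. -/
def O₁ : Op n := ∑ i ∈ T.S, (T.eigenvalue i : ℂ) • T.proj i

/-- `O₂ = ∑_{i ∈ S} |i⟩⟨i|`. -/
def O₂ : Op n := ∑ i ∈ T.S, T.proj i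

/-- The traceless observable `O₁' = O₁ - (Tr(O₁) / 2 ^ n) I`. -/
def O₁' : Op n := T.O₁ - (T.O₁.trace / 2 ^ n) • (1 : Op n)

/-- The traceless observable `O₂' = O₂ - (Tr(O₂) / 2 ^ n) I`. -/
def O₂' : Op n := T.O₂ - (T.O₂.trace / 2 ^ n) • (1 : Op n)

/-- The probability `pᵢ = ⟨i|ρ|i⟩` of measuring `|i⟩` in the state `ρ`. -/
def prob (ρ : Op n) (i : Bits n) : ℝ :=
  (star (WithLp.ofLp (T.eigenbasis i)) ⬝ᵥ (ρ *ᵥ WithLp.ofLp (T.eigenbasis i))).re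

/-- The cost `C₁ = (∑_{i ∈ S} λᵢ pᵢ) / (∑_{i ∈ S} pᵢ)` in the truncated subspace. -/
def C₁ (ρ : Op n) : ℝ := (∑ i ∈ T.S, T.eigenvalue i * T.prob ρ i) / ∑ i ∈ T.S, T.prob ρ i

/-- The cost `C₂ = Tr(ρ O₁') / Tr(ρ O₂')` with traceless observables. -/
def C₂ (ρ : Op n) : ℝ := (ρ * T.O₁').trace.re / (ρ * T.O₂').trace.re

/-- `k₁ = Tr(O₁) / 2 ^ n`. -/
def k₁ : ℝ := identityCoeff T.O₁

/-- `k₂ = Tr(O₂) / 2 ^ n`. -/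
def k₂ : ℝ := identityCoeff T.O₂

/-- The Pauli coefficients in `O₁ = k₁ I + w₁ · σ`. -/
def w₁ : EuclideanSpace ℝ (NontrivialString n) := pauliVec T.O₁

/-- The Pauli coefficients in `O₂ = k₂ I + w₂ · σ`. -/
def w₂ : EuclideanSpace ℝ (NontrivialString n) := pauliVec T.O₂

/-- The constant `s`, for noise strength `q`, a number `ε > 0`, a depth `L₀` and the generator
`H = H_{lm}` of the parameter. The denominator of the first entry of the minimum vanishes only
if `H` is a multiple of the identity or if `λᵢ` is the same for all `i ∈ S`; in both cases the
gradients of `C₁` and of `C₂` are zero, so that the value of `s` plays no role. -/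
def s (q ε : ℝ) (L₀ : ℕ) (H : Op n) : ℝ :=
  min
    (ε ^ 2 * T.k₂ ^ 2 /
      ((1 + ε) ^ 2 * √(2 ^ (n + 1) - 2) * numNonzero (pauliVec H) * maxNorm (pauliVec H)
        * ‖T.k₂ • T.w₁ - T.k₁ • T.w₂‖))
    ((|T.k₂| / (q ^ L₀ * √(2 ^ n - 1) * ‖T.w₂‖) - q ^ (L₀ + 1)) ^ 2)

end TruncatedObservable

end NoisyVQA

end

noncomputable section

namespace NoisyVQA

variable {n : ℕ}

/-! ### The Pauli basis -/

/-! Let `v` be the Pauli vector of the output state and `aᵢ = 2ⁿ⟨v, wᵢ⟩`. Then `C₁ = (k₁ + a₁)/(k₂ +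
a₂)` and `C₂ = a₁/a₂` (`C₁_eq`, `C₂_eq`): the costs differ only by the identity coefficients. The
quotient rule gives `(k₂ + a₂)² ∂C₁ = a₂² ∂C₂ + D`, with `D = k₂ ∂a₁ - k₁ ∂a₂ = 2ⁿ⟨∂v, k₂w₁ -
k₁w₂⟩`.

Noise makes the right side small. The norm of the Pauli vector is, up to scale, the Frobenius norm
of the traceless part, so unitaries preserve it, while each layer of noise multiplies it by at most
`q` (`norm_pauliVec_tensorPower_le`). Hence `a₂` is of order `q ^ L`. So is `D`, because a change of
one parameter moves the state by a commutator with `H_{lm}`, and this displacement suffers the same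
contractions (`exists_hasDerivAt_pauliVec_noisyState`). Meanwhile `k₂ + a₂` stays away from `0`,
since `L` is well beyond `L₀`.

The two entries of `s` are chosen so that `s |D|` and `s a₂²` are both at most `q ^ (L + 1) (k₂ +
a₂)²`. Dividing by `(k₂ + a₂)²` yields `s |∂C₁| ≤ q ^ (L + 1) (|∂C₂| + 1)`, which is the claim;
`gradient_bound` carries out this part with real numbers only. -/

lemma sum_pauli_mul_pauli (i j k l : Fin 2) :
    ∑ a, pauli a i j * pauli a k l = if i = l ∧ j = k then 2 else 0 := by
  fin_cases i <;> fin_cases j <;> fin_cases k <;> fin_cases l <;>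
    simp [pauli, Fin.sum_univ_four] <;> norm_num

lemma star_pauli_apply (a : Fin 4) (i j : Fin 2) : star (pauli a i j) = pauli a j i := by
  fin_cases a <;> fin_cases i <;> fin_cases j <;> simp [pauli]

lemma pauli_mul_self (a : Fin 4) : pauli a * pauli a = 1 := by
  fin_cases a <;> ext i j <;> fin_cases i <;> fin_cases j <;>
    simp [pauli, Matrix.mul_apply, Fin.sum_univ_two]

/-- Completeness of the Pauli strings: `∑ σ ⊗ σ` is `2ⁿ` times the swap operator, qubit by qubit.
Contracting with operators gives both the Pauli expansion and Parseval's identity, with no separate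
argument for linear independence. -/
lemma sum_pauliString_mul_pauliString (x y x' y' : Bits n) :
    ∑ p : Fin n → Fin 4, pauliString p x y * pauliString p x' y' =
      if x = y' ∧ y = x' then 2 ^ n else 0 := by
  have h : ∀ p : Fin n → Fin 4, pauliString p x y * pauliString p x' y' =
      ∏ k, pauli (p k) (x k) (y k) * pauli (p k) (x' k) (y' k) := by
    intro p
    simp [pauliString, Finset.prod_mul_distrib]
  simp_rw [h]
  rw [← Fintype.piFinset_univ,
    ← Finset.prod_univ_sum (fun _ : Fin n => (Finset.univ : Finset (Fin 4)))
      (fun k a => pauli a (x k) (y k) * pauli a (x' k) (y' k))]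
  simp_rw [sum_pauli_mul_pauli]
  split_ifs with hxy
  · obtain ⟨rfl, rfl⟩ := hxy
    simp
  · have : ∃ k, ¬ (x k = y' k ∧ y k = x' k) := by
      by_contra! hcon
      exact hxy ⟨funext fun k => (hcon k).1, funext fun k => (hcon k).2⟩
    obtain ⟨k, hk⟩ := this
    exact Finset.prod_eq_zero (Finset.mem_univ k) (if_neg hk)

lemma pauliString_isHermitian (p : Fin n → Fin 4) : (pauliString p).IsHermitian := by
  ext x y
  simp only [Matrix.conjTranspose_apply, pauliString, Matrix.of_apply, star_prod,
    star_pauli_apply]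

lemma pauliString_zero : pauliString (0 : Fin n → Fin 4) = 1 := by
  ext x y
  simp only [pauliString, Matrix.of_apply, Pi.zero_apply]
  have : ∀ k, pauli 0 (x k) (y k) = if x k = y k then 1 else 0 := fun k => by
    simp [pauli, Matrix.one_apply]
  simp_rw [this, Matrix.one_apply, funext_iff]
  rw [Finset.prod_ite_zero]
  simp

lemma pauliString_mul_self (p : Fin n → Fin 4) : pauliString p * pauliString p = 1 := by
  ext x z
  simp only [Matrix.mul_apply, pauliString, Matrix.of_apply, ← Finset.prod_mul_distrib]
  rw [← Fintype.piFinset_univ,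
    ← Finset.prod_univ_sum (fun _ : Fin n => (Finset.univ : Finset (Fin 2)))
      (fun k a => pauli (p k) (x k) a * pauli (p k) a (z k))]
  simp_rw [← Matrix.mul_apply, pauli_mul_self, Matrix.one_apply, funext_iff]
  rw [Finset.prod_ite_zero]
  simp

lemma trace_mul_eq_sum (M N : Op n) : (M * N).trace = ∑ x, ∑ y, M x y * N y x := by
  simp [Matrix.trace, Matrix.mul_apply]

lemma sum_trace_smul_pauliString (M : Op n) :
    ∑ p : Fin n → Fin 4, (M * pauliString p).trace • pauliString p = (2 ^ n : ℂ) • M := by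
  ext x y
  simp only [Matrix.sum_apply, Matrix.smul_apply, smul_eq_mul, trace_mul_eq_sum, Finset.sum_mul,
    mul_assoc]
  rw [Finset.sum_comm]
  simp_rw [Finset.sum_comm (s := (Finset.univ : Finset (Fin n → Fin 4))), ← Finset.mul_sum,
    sum_pauliString_mul_pauliString]
  rw [Finset.sum_eq_single x, Finset.sum_eq_single y]
  · simp [mul_comm]
  · intro b _ hb
    simp [hb]
  · simp
  · intro b _ hb
    simp [hb]
  · simp

lemma sum_trace_mul_trace (M N : Op n) :
    ∑ p : Fin n → Fin 4, (M * pauliString p).trace * (N * pauliString p).trace =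
      2 ^ n * (M * N).trace := by
  have h := congrArg (fun X => (N * X).trace) (sum_trace_smul_pauliString M)
  simp only [Matrix.mul_sum, Matrix.trace_sum, Matrix.mul_smul, Matrix.trace_smul,
    smul_eq_mul] at h
  rw [h, Matrix.trace_mul_comm N M]

lemma trace_mul_im {M N : Op n} (hM : M.IsHermitian) (hN : N.IsHermitian) :
    (M * N).trace.im = 0 := by
  have h : star (M * N).trace = (M * N).trace := by
    rw [← Matrix.trace_conjTranspose, Matrix.conjTranspose_mul, hM.eq, hN.eq,
      Matrix.trace_mul_comm]
  exact Complex.conj_eq_iff_im.mp h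

lemma trace_im {M : Op n} (hM : M.IsHermitian) : M.trace.im = 0 := by
  simpa using trace_mul_im hM (Matrix.isHermitian_one)

lemma ofReal_trace_re {M : Op n} (hM : M.IsHermitian) : (M.trace.re : ℂ) = M.trace :=
  Complex.ext rfl (by simp [trace_im hM])

lemma ofReal_trace_mul_re {M N : Op n} (hM : M.IsHermitian) (hN : N.IsHermitian) :
    ((M * N).trace.re : ℂ) = (M * N).trace :=
  Complex.ext rfl (by simp [trace_mul_im hM hN])

/-- `pauliVec` as a real-linear map. -/
def pauliVecₗ (n : ℕ) : Op n →ₗ[ℝ] EuclideanSpace ℝ (NontrivialString n) where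
  toFun := pauliVec
  map_add' M N := by
    ext p
    simp [pauliVec, add_mul, add_div]
  map_smul' c M := by
    ext p
    simp [pauliVec, mul_div_assoc]

lemma pauliVecₗ_apply (M : Op n) : pauliVecₗ n M = pauliVec M := rfl

lemma pauliVec_apply (M : Op n) (p : NontrivialString n) :
    pauliVec M p = (M * pauliString p.1).trace.re / 2 ^ n := rfl

lemma pauliVec_one : pauliVec (1 : Op n) = 0 := by
  ext ⟨p, hp⟩
  rw [pauliVec_apply, one_mul, PiLp.zero_apply]
  have h := congrArg Complex.re (sum_trace_mul_trace (pauliString p) 1)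
  have h0 : (pauliString p : Op n).trace = 0 := by
    obtain ⟨k, hk⟩ := Function.ne_iff.mp hp
    have : (pauliString p : Op n).trace = ∑ x : Bits n, ∏ k, pauli (p k) (x k) (x k) := rfl
    rw [this, ← Fintype.piFinset_univ,
      ← Finset.prod_univ_sum (fun _ : Fin n => (Finset.univ : Finset (Fin 2)))
        (fun k a => pauli (p k) a a)]
    refine Finset.prod_eq_zero (Finset.mem_univ k) ?_
    generalize p k = a at hk
    fin_cases a
    · simp at hk
    · simp [pauli]
    · simp [pauli]
    · simp [pauli]
  simp [h0]

/-- Parseval's identity in the Pauli basis. -/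
lemma inner_pauliVec {M N : Op n} (hM : M.IsHermitian) (hN : N.IsHermitian) :
    2 ^ n * (inner ℝ (pauliVec M) (pauliVec N) + identityCoeff M * identityCoeff N) =
      (M * N).trace.re := by
  have h2 : (2 : ℝ) ^ n ≠ 0 := by positivity
  have h := sum_trace_mul_trace M N
  have h' : ∑ p : Fin n → Fin 4, (M * pauliString p).trace.re * (N * pauliString p).trace.re =
      2 ^ n * (M * N).trace.re := by
    have hp := pauliString_isHermitian (n := n)
    rw [← Complex.ofReal_inj]
    push_cast
    simp_rw [fun p => ofReal_trace_mul_re hM (hp p), fun p => ofReal_trace_mul_re hN (hp p),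
      ofReal_trace_mul_re hM hN]
    exact h
  rw [Fintype.sum_eq_add_sum_subtype_ne _ (0 : Fin n → Fin 4), pauliString_zero, mul_one,
    mul_one] at h'
  have h3 : inner ℝ (pauliVec M) (pauliVec N) =
      (∑ p : NontrivialString n, (M * pauliString p.1).trace.re * (N * pauliString p.1).trace.re)
        / (2 ^ n * 2 ^ n) := by
    rw [PiLp.inner_apply, Finset.sum_div]
    refine Finset.sum_congr rfl fun p _ => ?_
    simp only [pauliVec_apply, RCLike.inner_apply, conj_trivial]
    field_simp
  rw [h3, identityCoeff, identityCoeff]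
  field_simp
  linarith

lemma norm_pauliVec_sq {M : Op n} (hM : M.IsHermitian) :
    2 ^ n * (‖pauliVec M‖ ^ 2 + identityCoeff M ^ 2) = (M * M).trace.re := by
  rw [← inner_pauliVec hM hM, real_inner_self_eq_norm_sq, sq (identityCoeff M)]

lemma eq_identityCoeff_add_sum {M : Op n} (hM : M.IsHermitian) :
    M = (identityCoeff M : ℂ) • (1 : Op n) +
      ∑ p : NontrivialString n, ((pauliVec M p : ℝ) : ℂ) • pauliString p.1 := by
  have h := sum_trace_smul_pauliString M
  have h2 : (2 : ℂ) ^ n ≠ 0 := by positivity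
  rw [Fintype.sum_eq_add_sum_subtype_ne _ (0 : Fin n → Fin 4), pauliString_zero, mul_one] at h
  have h' := congrArg (fun X => ((2 : ℂ) ^ n)⁻¹ • X) h
  simp only [smul_smul, inv_mul_cancel₀ h2, one_smul, smul_add, Finset.smul_sum] at h'
  conv_lhs => rw [← h']
  congr 1
  · rw [identityCoeff, Complex.ofReal_div, ofReal_trace_re hM]
    push_cast
    rw [div_eq_inv_mul]
  · refine Finset.sum_congr rfl fun p _ => ?_
    rw [pauliVec_apply, Complex.ofReal_div, ofReal_trace_mul_re hM (pauliString_isHermitian _)]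
    push_cast
    rw [div_eq_inv_mul]

/-! ### Conjugations and commutators -/

/-- By Parseval the norm depends only on `Tr M` and `Tr M²`, and conjugation by `√c` times a unitary
scales these by `c` and `c²`. The factor `c` serves for `1 ± iP`, where `c = 2`. -/
lemma norm_pauliVec_conj {W M : Op n} {c : ℝ} (hc : 0 ≤ c) (hW : Wᴴ * W = (c : ℂ) • (1 : Op n))
    (hM : M.IsHermitian) : ‖pauliVec (W * M * Wᴴ)‖ = c * ‖pauliVec M‖ := by
  have hWM : (W * M * Wᴴ).IsHermitian := Matrix.isHermitian_mul_mul_conjTranspose W hM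
  have h1 : (W * M * Wᴴ).trace = c * M.trace := by
    rw [Matrix.trace_mul_comm, ← mul_assoc, hW]
    simp
  have h2 : (W * M * Wᴴ * (W * M * Wᴴ)).trace = c ^ 2 * (M * M).trace := by
    have : W * M * Wᴴ * (W * M * Wᴴ) = (c : ℂ) • (W * (M * M) * Wᴴ) := by
      calc W * M * Wᴴ * (W * M * Wᴴ) = W * M * (Wᴴ * W) * M * Wᴴ := by simp only [mul_assoc]
        _ = _ := by rw [hW]; simp [mul_assoc]
    rw [this, Matrix.trace_smul, Matrix.trace_mul_comm, ← mul_assoc, hW]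
    simp
    ring
  have hi : identityCoeff (W * M * Wᴴ) = c * identityCoeff M := by
    rw [identityCoeff, identityCoeff, h1, Complex.re_ofReal_mul, mul_div_assoc]
  have h3 := norm_pauliVec_sq hWM
  have h4 := norm_pauliVec_sq hM
  rw [h2, hi, ← Complex.ofReal_pow, Complex.re_ofReal_mul, ← h4] at h3
  have h5 : (2 : ℝ) ^ n ≠ 0 := by positivity
  have h6 : ‖pauliVec (W * M * Wᴴ)‖ ^ 2 = (c * ‖pauliVec M‖) ^ 2 := by
    apply mul_left_cancel₀ h5
    linear_combination h3
  exact (pow_left_inj₀ (norm_nonneg _) (by positivity) two_ne_zero).mp h6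

lemma norm_pauliVec_unitary_conj {W M : Op n} (hW : Wᴴ * W = 1) (hM : M.IsHermitian) :
    ‖pauliVec (W * M * Wᴴ)‖ = ‖pauliVec M‖ := by
  simpa using norm_pauliVec_conj zero_le_one (by simpa using hW) hM

/-- The commutator `-i [G, M]`. -/
def commutator (G M : Op n) : Op n := -Complex.I • (G * M - M * G)

/-- For a Hermitian involution `P`, the operator `-i [P, M]` is half the difference of the
conjugates of `M` by `1 - iP` and by `1 + iP`, both of which are `√2` times a unitary. -/
lemma norm_pauliVec_commutator_le {P M : Op n} (hP : P.IsHermitian) (hP2 : P * P = 1)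
    (hM : M.IsHermitian) : ‖pauliVec (commutator P M)‖ ≤ 2 * ‖pauliVec M‖ := by
  set W : Op n := 1 - Complex.I • P with hWdef
  set V : Op n := 1 + Complex.I • P with hVdef
  have hWt : Wᴴ = V := by
    simp [hWdef, hVdef, hP.eq]
  have hVt : Vᴴ = W := by rw [← hWt, Matrix.conjTranspose_conjTranspose]
  have hVW : V * W = ((2 : ℝ) : ℂ) • (1 : Op n) := by
    simp only [hWdef, hVdef, add_mul, mul_sub, one_mul, mul_one, smul_mul_smul_comm, hP2,
      Complex.I_mul_I]
    push_cast
    module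
  have hWV : W * V = ((2 : ℝ) : ℂ) • (1 : Op n) := by
    simp only [hWdef, hVdef, mul_add, sub_mul, one_mul, mul_one, smul_mul_smul_comm, hP2,
      Complex.I_mul_I]
    push_cast
    module
  have key : commutator P M = (1 / 2 : ℝ) • (W * M * Wᴴ - V * M * Vᴴ) := by
    rw [hWt, hVt]
    simp only [commutator, hWdef, hVdef, add_mul, sub_mul, mul_add, mul_sub, one_mul, mul_one,
      Matrix.smul_mul, Matrix.mul_smul]
    module
  have e : pauliVec (commutator P M) =
      (1 / 2 : ℝ) • (pauliVec (W * M * Wᴴ) - pauliVec (V * M * Vᴴ)) := by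
    simp only [key, ← pauliVecₗ_apply, map_smul, map_sub]
  have h1 : ‖pauliVec (W * M * Wᴴ)‖ = 2 * ‖pauliVec M‖ :=
    norm_pauliVec_conj zero_le_two (by rw [hWt, hVW]) hM
  have h2 : ‖pauliVec (V * M * Vᴴ)‖ = 2 * ‖pauliVec M‖ :=
    norm_pauliVec_conj zero_le_two (by rw [hVt, hWV]) hM
  rw [e, norm_smul, Real.norm_of_nonneg (by norm_num)]
  have := norm_sub_le (pauliVec (W * M * Wᴴ)) (pauliVec (V * M * Vᴴ))
  linarith

lemma sum_abs_le_numNonzero_mul_maxNorm (w : EuclideanSpace ℝ (NontrivialString n)) :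
    ∑ p, |w p| ≤ numNonzero w * maxNorm w := by
  classical
  have h1 : ∑ p, |w p| = ∑ p ∈ Finset.univ.filter (fun p => w p ≠ 0), |w p| := by
    rw [Finset.sum_filter]
    refine Finset.sum_congr rfl fun p _ => ?_
    split_ifs with h
    · rfl
    · simpa using h
  have h2 : numNonzero w = (Finset.univ.filter (fun p => w p ≠ 0)).card := by
    rw [numNonzero, Set.ncard_eq_toFinset_card']
    congr 1
    ext p
    simp
  rw [h1, h2, ← nsmul_eq_mul]
  exact Finset.sum_le_card_nsmul _ _ _ fun p _ => norm_le_pi_norm (WithLp.ofLp w) p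

/-- The identity part of `H` commutes with `M`, and each Pauli string is a Hermitian involution
costing a factor `2`. This gives `2‖η‖₁`, and `‖η‖₁` is at most the number of non-zero entries times
the largest one. -/
lemma norm_pauliVec_commutator_le_of_isHermitian {H M : Op n} (hH : H.IsHermitian)
    (hM : M.IsHermitian) :
    ‖pauliVec (commutator H M)‖ ≤
      2 * (numNonzero (pauliVec H) * maxNorm (pauliVec H)) * ‖pauliVec M‖ := by
  have e : commutator H M = ∑ p : NontrivialString n,
      pauliVec H p • commutator (pauliString p.1) M := by
    conv_lhs => rw [eq_identityCoeff_add_sum hH]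
    simp only [commutator, add_mul, mul_add, Finset.sum_mul, Finset.mul_sum, Matrix.smul_mul,
      Matrix.mul_smul, one_mul, mul_one, add_sub_add_left_eq_sub]
    rw [← Finset.sum_sub_distrib, Finset.smul_sum]
    refine Finset.sum_congr rfl fun p _ => ?_
    rw [← Complex.coe_smul, ← smul_sub, smul_comm]
  have e2 : pauliVec (commutator H M) =
      ∑ p : NontrivialString n, pauliVec H p • pauliVec (commutator (pauliString p.1) M) := by
    rw [← pauliVecₗ_apply, e, map_sum]
    simp only [map_smul, pauliVecₗ_apply]
  calc ‖pauliVec (commutator H M)‖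
      ≤ ∑ p : NontrivialString n, |pauliVec H p| * (2 * ‖pauliVec M‖) := by
        rw [e2]
        refine norm_sum_le_of_le _ fun p _ => ?_
        rw [norm_smul, Real.norm_eq_abs]
        exact mul_le_mul_of_nonneg_left (norm_pauliVec_commutator_le (pauliString_isHermitian _)
          (pauliString_mul_self _) hM) (abs_nonneg _)
    _ ≤ (numNonzero (pauliVec H) * maxNorm (pauliVec H)) * (2 * ‖pauliVec M‖) := by
        rw [← Finset.sum_mul]
        exact mul_le_mul_of_nonneg_right (sum_abs_le_numNonzero_mul_maxNorm _) (by positivity)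
    _ = _ := by ring

/-! ### Density operators -/

/-- Nonnegative `2 × 2` principal minors give `|ρ x y|² ≤ ρ x x * ρ y y`; sum over all `x` and `y`.
-/
lemma trace_mul_self_re_le {ρ : Op n} (hρ : ρ.PosSemidef) :
    (ρ * ρ).trace.re ≤ ρ.trace.re ^ 2 := by
  have hd : ∀ x, ((ρ x x).re : ℂ) = ρ x x := fun x => by
    have h := hρ.diag_nonneg (i := x)
    rw [Complex.le_def] at h
    exact Complex.ext rfl (by simpa using h.2)
  have h : ∀ x y, (ρ x y * ρ y x).re ≤ (ρ x x).re * (ρ y y).re := by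
    intro x y
    have h := (hρ.submatrix ![x, y]).det_nonneg
    rw [Matrix.det_fin_two] at h
    simp only [Matrix.submatrix_apply, Matrix.cons_val_zero, Matrix.cons_val_one] at h
    have h1 := (Complex.le_def.mp h).1
    rw [← hd x, ← hd y] at h1
    simpa using h1
  rw [trace_mul_eq_sum, Matrix.trace, sq]
  simp only [Complex.re_sum, Finset.sum_mul_sum, Matrix.diag_apply]
  exact Finset.sum_le_sum fun x _ => Finset.sum_le_sum fun y _ => h x y

lemma norm_pauliVec_le_of_trace_mul_self_le_one {ρ : Op n} (hρ : ρ.IsHermitian)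
    (htr : ρ.trace = 1) (h : (ρ * ρ).trace.re ≤ 1) :
    2 ^ n * ‖pauliVec ρ‖ ≤ √(2 ^ n - 1) := by
  have h1 := norm_pauliVec_sq hρ
  rw [identityCoeff, htr, Complex.one_re] at h1
  have h2 : (0 : ℝ) < 2 ^ n := by positivity
  apply Real.le_sqrt_of_sq_le
  have h3 : (2 : ℝ) ^ n * (2 ^ n * (‖pauliVec ρ‖ ^ 2 + (1 / 2 ^ n) ^ 2)) ≤ 2 ^ n * 1 :=
    mul_le_mul_of_nonneg_left (h1.le.trans h) h2.le
  have h4 : (2 : ℝ) ^ n * (2 ^ n * (‖pauliVec ρ‖ ^ 2 + (1 / 2 ^ n) ^ 2)) =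
      (2 ^ n * ‖pauliVec ρ‖) ^ 2 + 1 := by
    field_simp
  linarith

lemma IsDensity.norm_pauliVec_le {ρ : Op n} (hρ : IsDensity ρ) :
    2 ^ n * ‖pauliVec ρ‖ ≤ √(2 ^ n - 1) := by
  refine norm_pauliVec_le_of_trace_mul_self_le_one hρ.1.isHermitian hρ.2 ?_
  simpa [hρ.2] using trace_mul_self_re_le hρ.1

/-! ### The Pauli channel in the Pauli basis -/

/-- The factors by which the single-qubit Pauli channel multiplies `I, σ_X, σ_Y, σ_Z`. -/
def PauliNoise.factor (ν : PauliNoise) : Fin 4 → ℝ :=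
  ![1, 1 - 2 * ν.qY - 2 * ν.qZ, 1 - 2 * ν.qX - 2 * ν.qZ, 1 - 2 * ν.qX - 2 * ν.qY]

/-- The Pauli matrices are eigenvectors of the adjoint channel. Testing on matrix units matches the
definition of `tensorPower`, so that traces against strings factor over the qubits. -/
lemma PauliNoise.sum_channel_mul_pauli (ν : PauliNoise) (a : Fin 4) (i j : Fin 2) :
    ∑ x, ∑ y, ν.channel (Matrix.single i j 1) x y * pauli a y x = ν.factor a * pauli a j i := by
  have hs : Matrix.single i j (1 : ℂ) = !![if i = 0 ∧ j = 0 then 1 else 0,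
      if i = 0 ∧ j = 1 then 1 else 0; if i = 1 ∧ j = 0 then 1 else 0,
      if i = 1 ∧ j = 1 then 1 else 0] := by
    ext x y
    fin_cases x <;> fin_cases y <;> simp [Matrix.single]
  rw [hs]
  fin_cases a <;> fin_cases i <;> fin_cases j <;>
    simp [PauliNoise.channel, PauliNoise.factor, pauli, Fin.sum_univ_two] <;> ring_nf

lemma PauliNoise.star_channel_single (ν : PauliNoise) (i j x y : Fin 2) :
    star (ν.channel (Matrix.single i j 1) x y) = ν.channel (Matrix.single j i 1) y x := by
  have hp : ∀ a, (pauli a)ᴴ = pauli a := fun a => by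
    ext x y
    rw [Matrix.conjTranspose_apply, star_pauli_apply]
  have h : (ν.channel (Matrix.single i j 1))ᴴ = ν.channel (Matrix.single j i 1) := by
    simp [PauliNoise.channel, Matrix.conjTranspose_smul, hp, Matrix.mul_assoc]
  rw [← h, Matrix.conjTranspose_apply]

lemma PauliNoise.strength_nonneg (ν : PauliNoise) : 0 ≤ ν.strength :=
  le_max_of_le_left (abs_nonneg _)

lemma PauliNoise.strength_le_one (ν : PauliNoise) : ν.strength ≤ 1 := by
  obtain ⟨x, y, z, hx, hy, hz, h⟩ := ν
  refine max_le (abs_le.mpr ?_) (max_le (abs_le.mpr ?_) (abs_le.mpr ?_)) <;>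
    constructor <;> simp only <;> linarith

lemma PauliNoise.abs_factor_le (ν : PauliNoise) {a : Fin 4} (ha : a ≠ 0) :
    |ν.factor a| ≤ ν.strength := by
  fin_cases a
  · simp at ha
  · exact le_max_left _ _
  · exact (le_max_left _ _).trans (le_max_right _ _)
  · exact (le_max_right _ _).trans (le_max_right _ _)

lemma PauliNoise.abs_factor_le_one (ν : PauliNoise) (a : Fin 4) : |ν.factor a| ≤ 1 := by
  by_cases ha : a = 0
  · simp [ha, PauliNoise.factor]
  · exact (ν.abs_factor_le ha).trans ν.strength_le_one

/-- `tensorPower P` as a linear map. -/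
def tensorPowerₗ (P : Matrix (Fin 2) (Fin 2) ℂ → Matrix (Fin 2) (Fin 2) ℂ) : Op n →ₗ[ℝ] Op n where
  toFun := tensorPower P
  map_add' M N := by
    ext a b
    simp only [tensorPower, Matrix.add_apply, Matrix.sum_apply, Matrix.smul_apply, add_smul,
      Finset.sum_add_distrib]
  map_smul' c M := by
    ext a b
    simp only [tensorPower, RingHom.id_apply, Matrix.sum_apply, Matrix.smul_apply, smul_assoc,
      Finset.smul_sum]

lemma trace_tensorPower_mul_pauliString (ν : PauliNoise) (ρ : Op n) (p : Fin n → Fin 4) :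
    (tensorPower ν.channel ρ * pauliString p).trace =
      (∏ k, (ν.factor (p k) : ℂ)) * (ρ * pauliString p).trace := by
  have key : ∀ x y : Bits n, (Matrix.of (fun x' y' : Bits n =>
      ∏ k, ν.channel (Matrix.single (x k) (y k) 1) (x' k) (y' k)) * pauliString p).trace =
      (∏ k, (ν.factor (p k) : ℂ)) * pauliString p y x := by
    intro x y
    simp only [trace_mul_eq_sum, pauliString, Matrix.of_apply, ← Finset.prod_mul_distrib]
    simp_rw [← ν.sum_channel_mul_pauli, Fintype.prod_sum]
  simp only [tensorPower, Finset.sum_mul, Matrix.trace_sum, Matrix.smul_mul, Matrix.trace_smul,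
    key, trace_mul_eq_sum ρ, Finset.mul_sum, smul_eq_mul]
  refine Finset.sum_congr rfl fun x _ => Finset.sum_congr rfl fun y _ => ?_
  ring

lemma isHermitian_tensorPower (ν : PauliNoise) {ρ : Op n} (hρ : ρ.IsHermitian) :
    (tensorPower ν.channel ρ).IsHermitian := by
  ext a b
  simp only [tensorPower, Matrix.conjTranspose_apply, Matrix.sum_apply, Matrix.smul_apply,
    Matrix.of_apply, smul_eq_mul, star_sum, star_mul', star_prod, ν.star_channel_single]
  rw [Finset.sum_comm]
  simp_rw [hρ.apply]

lemma trace_tensorPower (ν : PauliNoise) (ρ : Op n) :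
    (tensorPower ν.channel ρ).trace = ρ.trace := by
  simpa [pauliString_zero, PauliNoise.factor] using trace_tensorPower_mul_pauliString ν ρ 0

/-- The channel is diagonal on Pauli strings. A nontrivial string has at least one non-identity
site, which contributes a factor at most `q`; the other sites contribute at most `1`. -/
lemma norm_pauliVec_tensorPower_le (ν : PauliNoise) (ρ : Op n) :
    ‖pauliVec (tensorPower ν.channel ρ)‖ ≤ ν.strength * ‖pauliVec ρ‖ := by
  have h : ∀ p, |pauliVec (tensorPower ν.channel ρ) p| ≤ ν.strength * |pauliVec ρ p| := by
    rintro ⟨p, hp⟩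
    have e : pauliVec (tensorPower ν.channel ρ) ⟨p, hp⟩ =
        (∏ k, ν.factor (p k)) * pauliVec ρ ⟨p, hp⟩ := by
      rw [pauliVec_apply, pauliVec_apply, trace_tensorPower_mul_pauliString,
        ← Complex.ofReal_prod, Complex.re_ofReal_mul, mul_div_assoc]
    rw [e, abs_mul, Finset.abs_prod]
    refine mul_le_mul_of_nonneg_right ?_ (abs_nonneg _)
    obtain ⟨k, hk⟩ := Function.ne_iff.mp hp
    rw [← Finset.mul_prod_erase _ _ (Finset.mem_univ k)]
    calc _ ≤ ν.strength * 1 := mul_le_mul (ν.abs_factor_le hk)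
          (Finset.prod_le_one (fun _ _ => abs_nonneg _) fun _ _ => ν.abs_factor_le_one _)
          (Finset.prod_nonneg fun _ _ => abs_nonneg _) ν.strength_nonneg
      _ = _ := mul_one _
  have hq := ν.strength_nonneg
  rw [← Real.sqrt_sq (mul_nonneg hq (norm_nonneg _)), EuclideanSpace.norm_eq]
  apply Real.sqrt_le_sqrt
  rw [mul_pow, EuclideanSpace.norm_sq_eq, Finset.mul_sum]
  refine Finset.sum_le_sum fun p _ => ?_
  rw [← mul_pow]
  exact pow_le_pow_left₀ (norm_nonneg _) (h p) 2

/-! ### Unitaries generated by Hermitian operators -/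

/-- The unitary `exp(-i G)`. -/
def expI (G : Op n) : Op n := NormedSpace.exp (-Complex.I • G)

lemma conjTranspose_expI {G : Op n} (hG : G.IsHermitian) : (expI G)ᴴ = expI (-G) := by
  rw [expI, ← Matrix.exp_conjTranspose, expI]
  simp [hG.eq]

lemma expI_mul_expI_neg (G : Op n) : expI G * expI (-G) = 1 := by
  have h : Commute (-Complex.I • G) (-Complex.I • -G) := by
    rw [smul_neg]
    exact (Commute.refl _).neg_right
  rw [expI, expI, ← Matrix.exp_add_of_commute _ _ h, smul_neg, add_neg_cancel,
    NormedSpace.exp_zero]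

lemma conjTranspose_expI_mul_self {G : Op n} (hG : G.IsHermitian) : (expI G)ᴴ * expI G = 1 := by
  rw [conjTranspose_expI hG]
  simpa using expI_mul_expI_neg (-G)

lemma isHermitian_commutator {G M : Op n} (hG : G.IsHermitian) (hM : M.IsHermitian) :
    (commutator G M).IsHermitian := by
  rw [commutator, Matrix.IsHermitian, Matrix.conjTranspose_smul, Matrix.conjTranspose_sub,
    Matrix.conjTranspose_mul, Matrix.conjTranspose_mul, hG.eq, hM.eq, star_neg, Complex.star_def,
    Complex.conj_I, neg_neg, ← neg_sub (G * M), smul_neg, neg_smul]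

lemma isHermitian_real_smul (s : ℝ) {X : Op n} (hX : X.IsHermitian) : (s • X).IsHermitian := by
  rw [Matrix.IsHermitian, Matrix.conjTranspose_smul, hX.eq, star_trivial]

section Calculus

-- Differentiating the exponential needs a normed algebra. The dimension is finite, so the choice of
-- norm does not affect derivatives; all estimates use the Pauli norm.
open scoped Matrix.Norms.Operator

lemma differentiableAt_linearMap_comp {E F : Type*} [NormedAddCommGroup E] [NormedSpace ℝ E]
    [FiniteDimensional ℝ E] [NormedAddCommGroup F] [NormedSpace ℝ F] (f : E →ₗ[ℝ] F) {g : ℝ → E}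
    {t : ℝ} (hg : DifferentiableAt ℝ g t) : DifferentiableAt ℝ (fun s => f (g s)) t :=
  (LinearMap.toContinuousLinearMap f).differentiableAt.comp t hg

lemma hasDerivAt_linearMap_comp {E F : Type*} [NormedAddCommGroup E] [NormedSpace ℝ E]
    [FiniteDimensional ℝ E] [NormedAddCommGroup F] [NormedSpace ℝ F] (f : E →ₗ[ℝ] F) {g : ℝ → E}
    {g' : E} {t : ℝ} (hg : HasDerivAt g g' t) : HasDerivAt (fun s => f (g s)) (f g') t :=
  (LinearMap.toContinuousLinearMap f).hasFDerivAt.comp_hasDerivAt t hg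

lemma hasDerivAt_expI_smul (G : Op n) (s : ℝ) :
    HasDerivAt (fun s : ℝ => expI (s • G)) (expI (s • G) * (-Complex.I • G)) s := by
  have h := hasDerivAt_exp_smul_const (𝕂 := ℝ) (-Complex.I • G) s
  have e : ∀ s : ℝ, expI (s • G) = NormedSpace.exp (s • (-Complex.I • G)) := fun s => by
    rw [expI, smul_comm]
  simp only [e]
  exact h

lemma hasDerivAt_expI_smul' (G : Op n) (s : ℝ) :
    HasDerivAt (fun s : ℝ => expI (s • G)) ((-Complex.I • G) * expI (s • G)) s := by
  have h := hasDerivAt_exp_smul_const' (𝕂 := ℝ) (-Complex.I • G) s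
  have e : ∀ s : ℝ, expI (s • G) = NormedSpace.exp (s • (-Complex.I • G)) := fun s => by
    rw [expI, smul_comm]
  simp only [e]
  exact h

lemma differentiableAt_expI_add_smul (G H : Op n) (t : ℝ) :
    DifferentiableAt ℝ (fun t : ℝ => expI (G + t • H)) t := by
  have h1 : DifferentiableAt ℝ (NormedSpace.exp : Op n → Op n) (-Complex.I • (G + t • H)) :=
    (NormedSpace.exp_analytic (𝕂 := ℝ) _).differentiableAt
  have h2 : DifferentiableAt ℝ (fun t : ℝ => -Complex.I • (G + t • H)) t := by fun_prop
  exact h1.comp t h2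

/-- Conjugation by `exp(-i (G + t H))` is Lipschitz in `t`. For the proof, the two unitaries are
joined by `V s = exp(i s G) exp(-i s G')`, and `V s * M * (V s)ᴴ` has a derivative that is the
conjugate of a commutator with `H`. -/
lemma norm_pauliVec_conj_expI_sub_le {G H M : Op n} (hG : G.IsHermitian) (hH : H.IsHermitian)
    (hM : M.IsHermitian) (t : ℝ) :
    ‖pauliVec (expI (G + t • H) * M * (expI (G + t • H))ᴴ - expI G * M * (expI G)ᴴ)‖ ≤
      2 * (numNonzero (pauliVec H) * maxNorm (pauliVec H)) * ‖pauliVec M‖ * |t| := by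
  set K : Op n := G + t • H with hK
  have hKh : K.IsHermitian := hG.add (isHermitian_real_smul t hH)
  set C := 2 * (numNonzero (pauliVec H) * maxNorm (pauliVec H)) * ‖pauliVec M‖ * |t|
  set Z : ℝ → Op n := fun s => expI (s • K) * M * expI (s • -K) with hZ
  set Y : ℝ → Op n := fun s => expI (s • -G) * Z s * expI (s • G) with hY
  have hZh : ∀ s, (Z s).IsHermitian := fun s => by
    have := Matrix.isHermitian_mul_mul_conjTranspose (expI (s • K)) hM
    rwa [conjTranspose_expI (isHermitian_real_smul s hKh), ← smul_neg] at this
  have hZd : ∀ s, HasDerivAt Z (commutator K (Z s)) s := fun s => by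
    have h := ((hasDerivAt_expI_smul' K s).mul_const M).mul (hasDerivAt_expI_smul (-K) s)
    convert! h using 1
    simp only [commutator, hZ, mul_assoc, smul_sub, Matrix.smul_mul, Matrix.mul_smul,
      smul_neg, neg_smul, neg_mul, neg_neg]
    abel
  -- The outer conjugation cancels the `G` part of `K = G + t • H`, so only `t` times a commutator
  -- with `H` remains.
  have hYd : ∀ s, HasDerivAt Y (t • (expI (s • -G) * commutator H (Z s) * expI (s • G))) s := by
    intro s
    have h := ((hasDerivAt_expI_smul (-G) s).mul (hZd s)).mul (hasDerivAt_expI_smul' G s)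
    convert! h using 1
    change _ = _ + expI (s • -G) * Z s * _
    simp only [commutator, hK, mul_assoc, add_mul, mul_add, smul_sub, smul_add, mul_sub, sub_mul,
      Matrix.smul_mul, Matrix.mul_smul, mul_neg, smul_neg, neg_smul, neg_mul, neg_neg]
    simp only [smul_comm t Complex.I]
    abel
  have hcomm : ∀ s, (commutator H (Z s)).IsHermitian := fun s => isHermitian_commutator hH (hZh s)
  have hbound : ∀ s, ‖pauliVec (t • (expI (s • -G) * commutator H (Z s) * expI (s • G)))‖ ≤ C := by
    intro s
    have e1 : expI (s • G) = (expI (s • -G))ᴴ := by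
      rw [conjTranspose_expI (isHermitian_real_smul s hG.neg), smul_neg, neg_neg]
    have e2 : expI (s • -K) = (expI (s • K))ᴴ := by
      rw [conjTranspose_expI (isHermitian_real_smul s hKh), smul_neg]
    have hz : ‖pauliVec (Z s)‖ = ‖pauliVec M‖ := by
      simp only [hZ, e2]
      exact norm_pauliVec_unitary_conj
        (conjTranspose_expI_mul_self (isHermitian_real_smul s hKh)) hM
    rw [← pauliVecₗ_apply, map_smul, norm_smul, pauliVecₗ_apply, e1,
      norm_pauliVec_unitary_conj
        (conjTranspose_expI_mul_self (isHermitian_real_smul s hG.neg)) (hcomm s),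
      Real.norm_eq_abs, mul_comm]
    refine mul_le_mul_of_nonneg_right ?_ (abs_nonneg t)
    rw [← hz]
    exact norm_pauliVec_commutator_le_of_isHermitian hH (hZh s)
  have hmv : ‖pauliVecₗ n (Y 1) - pauliVecₗ n (Y 0)‖ ≤ C :=
    norm_image_sub_le_of_norm_deriv_le_segment_01'
      (fun s _ => (hasDerivAt_linearMap_comp (pauliVecₗ n) (hYd s)).hasDerivWithinAt)
      (fun s _ => hbound s)
  rw [← map_sub] at hmv
  have h0 : Y 0 = M := by simp [hY, hZ, expI]
  have h1 : expI K * M * (expI K)ᴴ - expI G * M * (expI G)ᴴ = expI G * (Y 1 - Y 0) * (expI G)ᴴ := by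
    have e := expI_mul_expI_neg G
    rw [h0, mul_sub, sub_mul]
    congr 1
    rw [conjTranspose_expI hKh, conjTranspose_expI hG]
    simp only [hY, hZ, one_smul]
    calc expI K * M * expI (-K)
        = (expI G * expI (-G)) * (expI K * M * expI (-K)) * (expI G * expI (-G)) := by simp [e]
      _ = _ := by simp only [mul_assoc]
  have hYh : (Y 1 - Y 0).IsHermitian := by
    rw [h0]
    refine Matrix.IsHermitian.sub ?_ hM
    have := Matrix.isHermitian_mul_mul_conjTranspose (expI (-G)) (hZh 1)
    rw [conjTranspose_expI hG.neg, neg_neg] at this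
    simpa [hY] using this
  rw [h1, norm_pauliVec_unitary_conj (conjTranspose_expI_mul_self hG) hYh]
  exact hmv

end Calculus

/-! ### States of the noisy circuit -/

namespace Ansatz

variable (A : Ansatz n) (ν : PauliNoise)

/-- The Hermitian generator of layer `l`. -/
def generator (θ : A.Params) (l : ℕ) : Op n := ∑ j, ((θ l j : ℂ) • A.H l j + A.R l j)

lemma layerUnitary_eq (θ : A.Params) (l : ℕ) : A.layerUnitary θ l = expI (A.generator θ l) := rfl

lemma isHermitian_generator (θ : A.Params) (l : ℕ) : (A.generator θ l).IsHermitian := by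
  rw [Matrix.IsHermitian, generator, Matrix.conjTranspose_sum]
  refine Finset.sum_congr rfl fun j _ => ?_
  rw [Matrix.conjTranspose_add, Matrix.conjTranspose_smul, (A.H_hermitian l j).eq,
    (A.R_hermitian l j).eq]
  simp

lemma generator_setParam_self (θ : A.Params) (l : ℕ) (m : Fin (A.numParams l)) (t : ℝ) :
    A.generator (A.setParam θ l m t) l = A.generator θ l + (t - θ l m) • A.H l m := by
  rw [← sub_eq_iff_eq_add', generator, generator, ← Finset.sum_sub_distrib,
    Finset.sum_eq_single m]
  · rw [setParam, Function.update_self, Function.update_self, add_sub_add_right_eq_sub, ← sub_smul,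
      ← Complex.ofReal_sub, Complex.coe_smul]
  · intro j _ hj
    rw [setParam, Function.update_self, Function.update_of_ne hj, sub_self]
  · simp

lemma layerUnitary_setParam_of_ne (θ : A.Params) {l j : ℕ} (hj : j ≠ l) (m : Fin (A.numParams l))
    (t : ℝ) : A.layerUnitary (A.setParam θ l m t) j = A.layerUnitary θ j := by
  simp only [layerUnitary, setParam, Function.update_of_ne hj]

lemma setParam_self (θ : A.Params) (l : ℕ) (m : Fin (A.numParams l)) :
    A.setParam θ l m (θ l m) = θ := by
  simp [setParam]

lemma conjTranspose_layerUnitary_mul_self (θ : A.Params) (l : ℕ) :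
    (A.layerUnitary θ l)ᴴ * A.layerUnitary θ l = 1 :=
  conjTranspose_expI_mul_self (A.isHermitian_generator θ l)

lemma noisyState_setParam_of_le (ρ₀ : Op n) (θ : A.Params) {l : ℕ} (m : Fin (A.numParams l))
    (t : ℝ) {j : ℕ} (hj : j ≤ l) :
    A.noisyState ν ρ₀ (A.setParam θ l m t) j = A.noisyState ν ρ₀ θ j := by
  induction j with
  | zero => rfl
  | succ j ih =>
    rw [noisyState, noisyState, ih (by omega), A.layerUnitary_setParam_of_ne θ (by omega)]

lemma isHermitian_noisyState {ρ₀ : Op n} (hρ₀ : ρ₀.IsHermitian) (θ : A.Params) (L : ℕ) :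
    (A.noisyState ν ρ₀ θ L).IsHermitian := by
  induction L with
  | zero => exact hρ₀
  | succ L ih =>
    exact isHermitian_tensorPower ν (Matrix.isHermitian_mul_mul_conjTranspose _ ih)

lemma trace_noisyState (ρ₀ : Op n) (θ : A.Params) (L : ℕ) :
    (A.noisyState ν ρ₀ θ L).trace = ρ₀.trace := by
  induction L with
  | zero => rfl
  | succ L ih =>
    rw [noisyState, trace_tensorPower, Matrix.trace_mul_comm, ← mul_assoc,
      A.conjTranspose_layerUnitary_mul_self, one_mul, ih]

lemma norm_pauliVec_step_le {X : Op n} (hX : X.IsHermitian) (θ : A.Params) (l : ℕ) :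
    ‖pauliVec (tensorPower ν.channel (A.layerUnitary θ l * X * (A.layerUnitary θ l)ᴴ))‖ ≤
      ν.strength * ‖pauliVec X‖ := by
  rw [← norm_pauliVec_unitary_conj (A.conjTranspose_layerUnitary_mul_self θ l) hX]
  exact norm_pauliVec_tensorPower_le ν _

lemma norm_pauliVec_noisyState_le {ρ₀ : Op n} (hρ₀ : ρ₀.IsHermitian) (θ : A.Params) (L : ℕ) :
    ‖pauliVec (A.noisyState ν ρ₀ θ L)‖ ≤ ν.strength ^ L * ‖pauliVec ρ₀‖ := by
  induction L with
  | zero => simp [noisyState]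
  | succ L ih =>
    refine (A.norm_pauliVec_step_le ν (A.isHermitian_noisyState ν hρ₀ θ L) θ L).trans ?_
    rw [pow_succ', mul_assoc]
    exact mul_le_mul_of_nonneg_left ih ν.strength_nonneg

/-- The two circuits agree before layer `l`, where the states already carry `q ^ l`. Layer `l`
creates the difference, and every later layer acts on it by one and the same linear map. The noise
of layers `l, …, L - 1` supplies the rest of `q ^ L`. -/
lemma norm_pauliVec_noisyState_sub_le {ρ₀ : Op n} (hρ₀ : ρ₀.IsHermitian) (θ : A.Params) {l : ℕ}
    (m : Fin (A.numParams l)) (t : ℝ) {L : ℕ} (hL : l < L) :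
    ‖pauliVec (A.noisyState ν ρ₀ (A.setParam θ l m t) L - A.noisyState ν ρ₀ θ L)‖ ≤
      2 * (numNonzero (pauliVec (A.H l m)) * maxNorm (pauliVec (A.H l m))) *
        (ν.strength ^ L * ‖pauliVec ρ₀‖) * |t - θ l m| := by
  have hsub : ∀ X Y : Op n, tensorPower ν.channel X - tensorPower ν.channel Y =
      tensorPower ν.channel (X - Y) := fun X Y => ((tensorPowerₗ ν.channel).map_sub X Y).symm
  have hη : 0 ≤ 2 * (numNonzero (pauliVec (A.H l m)) * maxNorm (pauliVec (A.H l m))) :=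
    mul_nonneg zero_le_two (mul_nonneg (Nat.cast_nonneg _) (norm_nonneg _))
  induction L, hL using Nat.le_induction with
  | base =>
    have hh := A.isHermitian_noisyState ν hρ₀ θ l
    rw [noisyState, noisyState, hsub, A.noisyState_setParam_of_le ν ρ₀ θ m t le_rfl,
      layerUnitary_eq, layerUnitary_eq, generator_setParam_self]
    refine (norm_pauliVec_tensorPower_le ν _).trans ?_
    have h1 := norm_pauliVec_conj_expI_sub_le (A.isHermitian_generator θ l) (A.H_hermitian l m) hh
      (t - θ l m)
    have h2 := A.norm_pauliVec_noisyState_le ν hρ₀ θ l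
    calc _ ≤ ν.strength * (2 * (numNonzero (pauliVec (A.H l m)) * maxNorm (pauliVec (A.H l m))) *
          (ν.strength ^ l * ‖pauliVec ρ₀‖) * |t - θ l m|) :=
        mul_le_mul_of_nonneg_left (h1.trans (mul_le_mul_of_nonneg_right
          (mul_le_mul_of_nonneg_left h2 hη) (abs_nonneg _))) ν.strength_nonneg
      _ = _ := by rw [pow_succ]; ring
  | succ L hL ih =>
    rw [noisyState, noisyState, hsub, A.layerUnitary_setParam_of_ne θ (by omega : L ≠ l),
      ← sub_mul, ← mul_sub]
    refine (A.norm_pauliVec_step_le ν ((A.isHermitian_noisyState ν hρ₀ _ L).sub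
      (A.isHermitian_noisyState ν hρ₀ θ L)) θ L).trans ?_
    refine (mul_le_mul_of_nonneg_left ih ν.strength_nonneg).trans_eq ?_
    rw [pow_succ]
    ring

section Calculus

open scoped Matrix.Norms.Operator

lemma differentiableAt_noisyState (ρ₀ : Op n) (θ : A.Params) {l : ℕ}
    (m : Fin (A.numParams l)) (t : ℝ) {L : ℕ} (hL : l < L) :
    DifferentiableAt ℝ (fun t => A.noisyState ν ρ₀ (A.setParam θ l m t) L) t := by
  induction L, hL using Nat.le_induction with
  | base =>
    simp only [noisyState, A.noisyState_setParam_of_le ν ρ₀ θ m _ le_rfl, layerUnitary_eq,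
      generator_setParam_self]
    -- With the adjoint written as an exponential, both factors fall under
    -- `differentiableAt_expI_add_smul`.
    simp only [conjTranspose_expI ((A.isHermitian_generator θ l).add
      (isHermitian_real_smul _ (A.H_hermitian l m)))]
    refine differentiableAt_linearMap_comp (tensorPowerₗ ν.channel) ?_
    have hs : DifferentiableAt ℝ (fun t => t - θ l m) t := by fun_prop
    have h1 : DifferentiableAt ℝ
        (fun t => expI (A.generator θ l + (t - θ l m) • A.H l m)) t :=
      DifferentiableAt.comp (g := fun s : ℝ => expI (A.generator θ l + s • A.H l m)) t
        (differentiableAt_expI_add_smul _ _ _) hs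
    have h2 : DifferentiableAt ℝ
        (fun t => expI (-(A.generator θ l + (t - θ l m) • A.H l m))) t := by
      simp only [neg_add, ← smul_neg]
      exact DifferentiableAt.comp (g := fun s : ℝ => expI (-A.generator θ l + s • -A.H l m)) t
        (differentiableAt_expI_add_smul _ _ _) hs
    exact (h1.mul_const _).mul h2
  | succ L hL ih =>
    simp only [noisyState, A.layerUnitary_setParam_of_ne θ (by omega : L ≠ l)]
    refine differentiableAt_linearMap_comp (tensorPowerₗ ν.channel) ?_
    exact (ih.const_mul _).mul_const _

/-- The Lipschitz estimate passes to the derivative, so no formula for the derivative of the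
exponential along noncommuting directions is needed. -/
lemma exists_hasDerivAt_pauliVec_noisyState {ρ₀ : Op n} (hρ₀ : ρ₀.IsHermitian) (θ : A.Params)
    {l : ℕ} (m : Fin (A.numParams l)) {L : ℕ} (hL : l < L) :
    ∃ r : EuclideanSpace ℝ (NontrivialString n),
      HasDerivAt (fun t => pauliVec (A.noisyState ν ρ₀ (A.setParam θ l m t) L)) r (θ l m) ∧
      ‖r‖ ≤ 2 * (numNonzero (pauliVec (A.H l m)) * maxNorm (pauliVec (A.H l m))) *
        (ν.strength ^ L * ‖pauliVec ρ₀‖) := by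
  have hd : HasDerivAt (fun t => pauliVec (A.noisyState ν ρ₀ (A.setParam θ l m t) L)) _ (θ l m) :=
    (differentiableAt_linearMap_comp (pauliVecₗ n)
      (A.differentiableAt_noisyState ν ρ₀ θ m (θ l m) hL)).hasDerivAt
  refine ⟨_, hd, hd.le_of_lip' ?_ (Filter.Eventually.of_forall fun t => ?_)⟩
  · exact mul_nonneg (mul_nonneg zero_le_two (mul_nonneg (Nat.cast_nonneg _) (norm_nonneg _)))
      (mul_nonneg (pow_nonneg ν.strength_nonneg _) (norm_nonneg _))
  · have h := A.norm_pauliVec_noisyState_sub_le ν hρ₀ θ m t hL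
    rw [← pauliVecₗ_apply, map_sub] at h
    simpa only [A.setParam_self, Real.norm_eq_abs] using! h

end Calculus

end Ansatz

/-! ### Truncated observables -/

namespace TruncatedObservable

variable (T : TruncatedObservable n)

lemma isHermitian_proj (i : Bits n) : (T.proj i).IsHermitian := by
  rw [Matrix.IsHermitian, proj, Matrix.conjTranspose_vecMulVec, star_star]

lemma star_dotProduct_eigenbasis (i j : Bits n) :
    star (WithLp.ofLp (T.eigenbasis i)) ⬝ᵥ WithLp.ofLp (T.eigenbasis j) =
      if i = j then 1 else 0 := by
  rw [dotProduct_comm, ← EuclideanSpace.inner_eq_star_dotProduct]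
  exact orthonormal_iff_ite.mp T.eigenbasis.orthonormal i j

lemma proj_mul_proj (i j : Bits n) : T.proj i * T.proj j = if i = j then T.proj i else 0 := by
  rw [proj, proj, Matrix.vecMulVec_mul_vecMulVec, star_dotProduct_eigenbasis]
  split_ifs with h
  · simp [h]
  · simp

lemma trace_proj (i : Bits n) : (T.proj i).trace = 1 := by
  rw [proj, Matrix.trace_vecMulVec, dotProduct_comm, star_dotProduct_eigenbasis, if_pos rfl]

lemma prob_eq (ρ : Op n) (i : Bits n) : T.prob ρ i = (ρ * T.proj i).trace.re := by
  rw [prob, proj, Matrix.mul_vecMulVec, Matrix.trace_vecMulVec, dotProduct_comm]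

lemma isHermitian_O₁ : T.O₁.IsHermitian := by
  rw [Matrix.IsHermitian, O₁, Matrix.conjTranspose_sum]
  refine Finset.sum_congr rfl fun i _ => ?_
  rw [Matrix.conjTranspose_smul, (T.isHermitian_proj i).eq]
  simp

lemma isHermitian_O₂ : T.O₂.IsHermitian := by
  rw [Matrix.IsHermitian, O₂, Matrix.conjTranspose_sum]
  exact Finset.sum_congr rfl fun i _ => T.isHermitian_proj i

lemma sum_proj : ∑ i, T.proj i = 1 := by
  ext x y
  have h := congrArg (fun v : EuclideanSpace ℂ (Bits n) => v x)
    (T.eigenbasis.sum_repr' (EuclideanSpace.single y (1 : ℂ)))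
  simp only [WithLp.ofLp_sum, WithLp.ofLp_smul, Finset.sum_apply, Pi.smul_apply, smul_eq_mul,
    EuclideanSpace.inner_single_right, one_mul] at h
  rw [Matrix.sum_apply, Matrix.one_apply]
  simp only [proj, Matrix.vecMulVec_apply, Pi.star_apply]
  simpa [mul_comm, Pi.single_apply] using h

lemma trace_div_two_pow {M : Op n} (hM : M.IsHermitian) :
    M.trace / 2 ^ n = (identityCoeff M : ℂ) := by
  rw [identityCoeff, Complex.ofReal_div, ofReal_trace_re hM]
  push_cast
  rfl

lemma trace_mul_traceless {M ρ : Op n} (hM : M.IsHermitian) (hρ : ρ.IsHermitian)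
    (htr : ρ.trace = 1) :
    (ρ * (M - (M.trace / 2 ^ n) • (1 : Op n))).trace =
      ((2 ^ n * inner ℝ (pauliVec ρ) (pauliVec M) : ℝ) : ℂ) := by
  have h := inner_pauliVec hρ hM
  have h2 : (2 : ℝ) ^ n ≠ 0 := by positivity
  rw [trace_div_two_pow hM, mul_sub, Matrix.trace_sub, ← ofReal_trace_mul_re hρ hM, ← h,
    identityCoeff, htr]
  simp only [Matrix.mul_smul, mul_one, Matrix.trace_smul, htr, smul_eq_mul, Complex.one_re]
  rw [← Complex.ofReal_sub]
  congr 1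
  field_simp
  ring

lemma trace_mul_re_eq {M ρ : Op n} (hM : M.IsHermitian) (hρ : ρ.IsHermitian)
    (htr : ρ.trace = 1) :
    (ρ * M).trace.re = identityCoeff M + 2 ^ n * inner ℝ (pauliVec ρ) (pauliVec M) := by
  rw [← inner_pauliVec hρ hM, identityCoeff, identityCoeff, htr, Complex.one_re]
  field_simp
  ring

lemma C₂_eq {ρ : Op n} (hρ : ρ.IsHermitian) (htr : ρ.trace = 1) :
    T.C₂ ρ = (2 ^ n * inner ℝ (pauliVec ρ) T.w₁) / (2 ^ n * inner ℝ (pauliVec ρ) T.w₂) := by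
  rw [C₂, O₁', O₂', trace_mul_traceless T.isHermitian_O₁ hρ htr,
    trace_mul_traceless T.isHermitian_O₂ hρ htr, Complex.ofReal_re, Complex.ofReal_re, w₁, w₂]

lemma C₁_eq {ρ : Op n} (hρ : ρ.IsHermitian) (htr : ρ.trace = 1) :
    T.C₁ ρ = (T.k₁ + 2 ^ n * inner ℝ (pauliVec ρ) T.w₁) /
      (T.k₂ + 2 ^ n * inner ℝ (pauliVec ρ) T.w₂) := by
  rw [k₁, k₂, w₁, w₂, ← trace_mul_re_eq T.isHermitian_O₁ hρ htr,
    ← trace_mul_re_eq T.isHermitian_O₂ hρ htr, C₁]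
  simp only [prob_eq, O₁, O₂, Finset.mul_sum, Matrix.trace_sum, Complex.re_sum, Matrix.mul_smul,
    Matrix.trace_smul, smul_eq_mul, Complex.re_ofReal_mul]

/-- An eigenstate outside the truncated subspace shows that the traceless part of `O₂` is not small
compared with `k₂`. -/
lemma abs_k₂_le (h : T.w₂ ≠ 0) : |T.k₂| ≤ √(2 ^ n - 1) * ‖T.w₂‖ := by
  have hi : ∃ i, i ∉ T.S := by
    by_contra! hS
    refine h ?_
    have : T.O₂ = 1 := by
      rw [O₂, Finset.eq_univ_iff_forall.mpr hS, sum_proj]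
    rw [w₂, this, pauliVec_one]
  obtain ⟨i, hi⟩ := hi
  have hP := T.isHermitian_proj i
  have h0 : T.proj i * T.O₂ = 0 := by
    rw [O₂, Finset.mul_sum]
    refine Finset.sum_eq_zero fun j hj => ?_
    rw [proj_mul_proj, if_neg]
    rintro rfl
    exact hi hj
  have h1 := trace_mul_re_eq T.isHermitian_O₂ hP (T.trace_proj i)
  rw [h0, Matrix.trace_zero, Complex.zero_re] at h1
  have h2 : 2 ^ n * ‖pauliVec (T.proj i)‖ ≤ √(2 ^ n - 1) :=
    norm_pauliVec_le_of_trace_mul_self_le_one hP (T.trace_proj i)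
      (by rw [proj_mul_proj, if_pos rfl, trace_proj, Complex.one_re])
  have h3 : T.k₂ = -(2 ^ n * inner ℝ (pauliVec (T.proj i)) T.w₂) := by
    rw [k₂, w₂]
    linarith
  rw [h3, abs_neg, abs_mul, abs_of_pos (by positivity : (0 : ℝ) < 2 ^ n)]
  calc _ ≤ 2 ^ n * (‖pauliVec (T.proj i)‖ * ‖T.w₂‖) :=
        mul_le_mul_of_nonneg_left (abs_real_inner_le_norm _ _) (by positivity)
    _ = 2 ^ n * ‖pauliVec (T.proj i)‖ * ‖T.w₂‖ := by ring
    _ ≤ _ := mul_le_mul_of_nonneg_right h2 (norm_nonneg _)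

end TruncatedObservable

/-! ### The estimate of the gradients -/

/-- This is the numerical inequality behind the first entry of `s`. With `d = 2^(1/4)` and `u = √q`,
its square root reads `dε(1 + ε) ≤ u((1 + ε)² - u⁴)`. Replacing `u⁵` by `u³` leaves a function of
`u` that is concave on `[dε, 1]`, so the endpoints suffice. -/
lemma sqrt_two_mul_sq_le {q ε : ℝ} (hε : 0 < ε) (hq : q ≤ 1) (hεq : √2 * ε ^ 2 ≤ q) :
    √2 * ε ^ 2 * (1 + ε) ^ 2 ≤ q * ((1 + ε) ^ 2 - q ^ 2) ^ 2 := by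
  set r := √2 with hr
  have hr2 : r ^ 2 = 2 := Real.sq_sqrt zero_le_two
  have hr0 : 0 < r := Real.sqrt_pos.mpr two_pos
  set d := √r with hd
  have hd2 : d ^ 2 = r := Real.sq_sqrt hr0.le
  have hd0 : 0 < d := Real.sqrt_pos.mpr hr0
  have hq0 : 0 ≤ q := le_trans (by positivity) hεq
  set u := √q with hu
  have hu2 : u ^ 2 = q := Real.sq_sqrt hq0
  have hu0 : 0 ≤ u := Real.sqrt_nonneg q
  -- `1.4161 = 1.19²`, which serves the bound on `d`.
  have hr1 : r < 1.4161 := by nlinarith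
  have hd1 : d < 1.19 := by nlinarith
  have hd3 : 1 < d := by
    have : 1 < r := by nlinarith
    nlinarith
  have hu1 : u ≤ 1 := by nlinarith
  have hv : d * ε ≤ u := by
    rw [← hd2, ← hu2, ← mul_pow] at hεq
    exact le_of_sq_le_sq hεq hu0
  have hε1 : ε ≤ 1 := by nlinarith
  -- `hf1` and `hfv` are the values at `u = 1` and `u = dε` of the expression in `hf`.
  have hf1 : 0 ≤ 2 * ε + ε ^ 2 - d * ε - d * ε * ε := by nlinarith
  have hfv : 0 ≤ d * ε * (ε + ε ^ 2 - (d * ε) ^ 2) := by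
    refine mul_nonneg (by positivity) ?_
    rw [mul_pow, hd2]
    nlinarith
  have hf : 0 ≤ u - u ^ 3 + u * (2 * ε + ε ^ 2) - d * ε - d * ε * ε := by
    rcases eq_or_lt_of_le (hv.trans hu1) with h1 | h1
    · have : u = 1 := le_antisymm hu1 (h1 ▸ hv)
      rw [this]
      linarith
    -- `h2` is the concavity gap: `1 + u + dε` is the second divided difference of the cube at `dε,
    -- u, 1`.
    · have h2 : 0 ≤ (1 - d * ε) * ((u - d * ε) * (1 - u) * (1 + u + d * ε)) := by
        refine mul_nonneg (by linarith) (mul_nonneg (mul_nonneg ?_ ?_) ?_)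
        · linarith
        · linarith
        · positivity
      have h3 := mul_nonneg (sub_nonneg.mpr hv) hf1
      have h4 := mul_nonneg (sub_nonneg.mpr hu1) hfv
      refine nonneg_of_mul_nonneg_right (a := 1 - d * ε) ?_ (by linarith)
      linear_combination h2 + h3 + h4
  have hmain : d * ε * (1 + ε) ≤ u * ((1 + ε) ^ 2 - q ^ 2) := by
    rw [← hu2]
    have : u * u ^ 4 ≤ u ^ 3 := by
      have : u ^ 3 * u ^ 2 ≤ u ^ 3 * 1 := by
        refine mul_le_mul_of_nonneg_left ?_ (by positivity)
        rw [hu2]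
        exact hq
      linarith [show u * u ^ 4 = u ^ 3 * u ^ 2 by ring]
    nlinarith
  have := pow_le_pow_left₀ (by positivity) hmain 2
  rw [← hd2]
  calc _ = (d * ε * (1 + ε)) ^ 2 := by ring
    _ ≤ _ := this
    _ = _ := by rw [mul_pow u, hu2]

/-- Here `k = k₂`, `a = a₂`, `M = √(2ⁿ - 1) ‖w₂‖`, and `c₁`, `c₂` are the two derivatives. -/
lemma gradient_bound {q ε k M a B D c₁ c₂ s : ℝ} {L₀ L : ℕ} (hε : 0 < ε) (hq : q ≤ 1)
    (hεq : √2 * ε ^ 2 ≤ q) (hM : 0 < M) (hL₀ : q ^ L₀ * M * (1 + ε) ≤ |k|) (hkM : |k| ≤ M)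
    (hL : 2 * L₀ + 1 < L) (ha : |a| ≤ q ^ L * M) (hB : 0 ≤ B) (hD : |D| ≤ √2 * q ^ L * B)
    (hc : (k + a) ^ 2 * c₁ = a ^ 2 * c₂ + D) (hs0 : 0 ≤ s)
    (hs₁ : s ≤ ε ^ 2 * k ^ 2 / ((1 + ε) ^ 2 * B))
    (hs₂ : s ≤ (|k| / (q ^ L₀ * M) - q ^ (L₀ + 1)) ^ 2) :
    s / q ^ (L + 1) * |c₁| - 1 ≤ |c₂| := by
  have hq0 : 0 < q := lt_of_lt_of_le (by positivity) hεq
  set y := q ^ L₀ with hy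
  have hy0 : 0 < y := pow_pos hq0 _
  have hk0 : 0 < |k| := lt_of_lt_of_le (by positivity) hL₀
  -- The bound `|k| ≤ M` enters here; it gains a second factor `1 + ε` in `ha'`.
  have hy1 : y * (1 + ε) ≤ 1 := by
    refine le_of_mul_le_mul_right ?_ hM
    linarith
  have ha' : |a| * (1 + ε) ^ 2 ≤ |k| * q ^ 2 := by
    -- The depth condition gives `L ≥ 2 * L₀ + 2`, whence the factor `q ^ 2`.
    have h1 : q ^ L ≤ q ^ (L₀ + L₀ + 2) := pow_le_pow_of_le_one hq0.le hq (by omega)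
    have h2 : |a| ≤ y * y * q ^ 2 * M := by
      rw [pow_add, pow_add] at h1
      exact ha.trans (mul_le_mul_of_nonneg_right h1 hM.le)
    calc |a| * (1 + ε) ^ 2 ≤ y * y * q ^ 2 * M * (1 + ε) ^ 2 :=
          mul_le_mul_of_nonneg_right h2 (by positivity)
      _ = (y * (1 + ε)) * (y * M * (1 + ε)) * q ^ 2 := by ring
      _ ≤ 1 * |k| * q ^ 2 := by gcongr
      _ = _ := by ring
  have hε2 : (0 : ℝ) < (1 + ε) ^ 2 := by positivity
  have hak : |a| < |k| := by
    have h1 : q ^ 2 ≤ 1 := pow_le_one₀ hq0.le hq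
    nlinarith
  have hka : |k| - |a| ≤ |k + a| := by
    have := abs_sub_abs_le_abs_sub k (-a)
    rwa [abs_neg, sub_neg_eq_add] at this
  have hka0 : 0 < |k + a| := by linarith
  have hka2 : 0 < (k + a) ^ 2 := by rw [← sq_abs]; positivity
  have hQ : 0 < q ^ (L + 1) := pow_pos hq0 _
  have step1 : s * a ^ 2 ≤ q ^ (L + 1) * (k + a) ^ 2 := by
    -- Splitting `q ^ L = z * y` lets `y` cancel the denominator in `s`, and `z ^ 2 ≤ q ^ (L + 1)`
    -- because `2 * (L - L₀) ≥ L + 1`.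
    set z := q ^ (L - L₀) with hz
    have hz0 : 0 < z := pow_pos hq0 _
    have hzy : q ^ L = z * y := by rw [hz, hy, ← pow_add]; congr 1; omega
    have hz1 : z ≤ q ^ (L₀ + 1) := pow_le_pow_of_le_one hq0.le hq (by omega)
    have hz2 : z ^ 2 ≤ q ^ (L + 1) := by
      rw [hz, ← pow_mul]
      exact pow_le_pow_of_le_one hq0.le hq (by omega)
    have hK : q ^ (L₀ + 1) ≤ |k| / (y * M) := by
      have h1 : q ^ (L₀ + 1) ≤ 1 := pow_le_one₀ hq0.le hq
      refine h1.trans ?_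
      rw [one_le_div (by positivity)]
      nlinarith [mul_pos hy0 hM]
    have hKa : |a| * (|k| / (y * M)) ≤ z * |k| := by
      rw [← mul_div_assoc, div_le_iff₀ (by positivity)]
      calc |a| * |k| ≤ q ^ L * M * |k| := mul_le_mul_of_nonneg_right ha hk0.le
        _ = _ := by rw [hzy]; ring
    have h1 : |a| * (|k| / (y * M) - q ^ (L₀ + 1)) ≤ z * |k + a| := by
      have h2 : |a| * z ≤ |a| * q ^ (L₀ + 1) := mul_le_mul_of_nonneg_left hz1 (abs_nonneg _)
      have h3 : z * (|k| - |a|) ≤ z * |k + a| := mul_le_mul_of_nonneg_left hka hz0.le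
      linarith
    have h2 := pow_le_pow_left₀ (mul_nonneg (abs_nonneg a) (sub_nonneg.mpr hK)) h1 2
    calc s * a ^ 2 ≤ (|k| / (y * M) - q ^ (L₀ + 1)) ^ 2 * a ^ 2 :=
          mul_le_mul_of_nonneg_right hs₂ (sq_nonneg a)
      _ = (|a| * (|k| / (y * M) - q ^ (L₀ + 1))) ^ 2 := by rw [mul_pow, sq_abs]; ring
      _ ≤ (z * |k + a|) ^ 2 := h2
      _ = z ^ 2 * (k + a) ^ 2 := by rw [mul_pow, sq_abs]
      _ ≤ _ := mul_le_mul_of_nonneg_right hz2 hka2.le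
  have step2 : s * |D| ≤ q ^ (L + 1) * (k + a) ^ 2 := by
    rcases hB.eq_or_lt with hB0 | hB0
    -- Division by zero gives `0`, so a vanishing denominator forces `s = 0`.
    · have : s = 0 := le_antisymm (by simpa [← hB0] using hs₁) hs0
      rw [this, zero_mul]
      positivity
    · have h1 : s * ((1 + ε) ^ 2 * B) ≤ ε ^ 2 * k ^ 2 := (le_div_iff₀ (by positivity)).mp hs₁
      have h2 : |k| * ((1 + ε) ^ 2 - q ^ 2) ≤ (1 + ε) ^ 2 * |k + a| := by nlinarith
      have h3 : 0 ≤ (1 + ε) ^ 2 - q ^ 2 := by nlinarith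
      have h4 := pow_le_pow_left₀ (mul_nonneg hk0.le h3) h2 2
      have h5 := mul_le_mul_of_nonneg_left (sqrt_two_mul_sq_le hε hq hεq) (sq_nonneg k)
      have h6 : √2 * ε ^ 2 * k ^ 2 ≤ q * ((1 + ε) ^ 2 * (k + a) ^ 2) := by
        refine le_of_mul_le_mul_right ?_ hε2
        calc √2 * ε ^ 2 * k ^ 2 * (1 + ε) ^ 2 = k ^ 2 * (√2 * ε ^ 2 * (1 + ε) ^ 2) := by ring
          _ ≤ _ := h5
          _ = q * (|k| * ((1 + ε) ^ 2 - q ^ 2)) ^ 2 := by rw [mul_pow |k|, sq_abs]; ring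
          _ ≤ q * ((1 + ε) ^ 2 * |k + a|) ^ 2 := mul_le_mul_of_nonneg_left h4 hq0.le
          _ = _ := by rw [mul_pow, sq_abs]; ring
      refine le_of_mul_le_mul_right ?_ hε2
      calc s * |D| * (1 + ε) ^ 2 ≤ s * (√2 * q ^ L * B) * (1 + ε) ^ 2 := by gcongr
        _ = √2 * q ^ L * (s * ((1 + ε) ^ 2 * B)) := by ring
        _ ≤ √2 * q ^ L * (ε ^ 2 * k ^ 2) := by gcongr
        _ = q ^ L * (√2 * ε ^ 2 * k ^ 2) := by ring
        _ ≤ q ^ L * (q * ((1 + ε) ^ 2 * (k + a) ^ 2)) := by gcongr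
        _ = _ := by ring
  have hc' : (k + a) ^ 2 * |c₁| ≤ a ^ 2 * |c₂| + |D| := by
    have := abs_add_le (a ^ 2 * c₂) D
    rwa [← hc, abs_mul, abs_mul, abs_of_nonneg (sq_nonneg _), abs_of_nonneg (sq_nonneg a)] at this
  have hfin : s * |c₁| ≤ q ^ (L + 1) * (|c₂| + 1) := by
    refine le_of_mul_le_mul_left ?_ hka2
    calc (k + a) ^ 2 * (s * |c₁|) = s * ((k + a) ^ 2 * |c₁|) := by ring
      _ ≤ s * (a ^ 2 * |c₂| + |D|) := mul_le_mul_of_nonneg_left hc' hs0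
      _ = s * a ^ 2 * |c₂| + s * |D| := by ring
      _ ≤ q ^ (L + 1) * (k + a) ^ 2 * |c₂| + q ^ (L + 1) * (k + a) ^ 2 :=
        add_le_add (mul_le_mul_of_nonneg_right step1 (abs_nonneg _)) step2
      _ = _ := by ring
  rw [sub_le_iff_le_add, div_mul_eq_mul_div, div_le_iff₀ hQ]
  linarith

end NoisyVQA

end

theorem theorem3p1 {n : ℕ} (ν : NoisyVQA.PauliNoise) (A : NoisyVQA.Ansatz n)
    (ρ₀ : NoisyVQA.Op n) (hρ₀ : NoisyVQA.IsDensity ρ₀) (T : NoisyVQA.TruncatedObservable n)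
    (ε : ℝ) (hε : 0 < ε) (hεq : √2 * ε ^ 2 ≤ ν.strength)
    (L₀ : ℕ)
    (hL₀ : IsLeast {m : ℕ | ν.strength ^ m * √(2 ^ n - 1) * ‖T.w₂‖ * (1 + ε) ≤ |T.k₂|} L₀)
    (L : ℕ) (hL : 2 * L₀ + 1 < L)
    (l : ℕ) (hl : l < L) (m : Fin (A.numParams l)) (θ : A.Params)
    (hC₂ : (A.noisyState ν ρ₀ θ L * T.O₂').trace ≠ 0) :
    DifferentiableAt ℝ (fun t => T.C₁ (A.noisyState ν ρ₀ (A.setParam θ l m t) L)) (θ l m) ∧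
    DifferentiableAt ℝ (fun t => T.C₂ (A.noisyState ν ρ₀ (A.setParam θ l m t) L)) (θ l m) ∧
    |deriv (fun t => T.C₂ (A.noisyState ν ρ₀ (A.setParam θ l m t) L)) (θ l m)| ≥
      T.s ν.strength ε L₀ (A.H l m) / ν.strength ^ (L + 1) *
        |deriv (fun t => T.C₁ (A.noisyState ν ρ₀ (A.setParam θ l m t) L)) (θ l m)| - 1 := by
  have hherm : ∀ θ', (A.noisyState ν ρ₀ θ' L).IsHermitian := fun θ' =>
    A.isHermitian_noisyState ν hρ₀.1.isHermitian θ' L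
  have htr : ∀ θ', (A.noisyState ν ρ₀ θ' L).trace = 1 := fun θ' =>
    (A.trace_noisyState ν ρ₀ θ' L).trans hρ₀.2
  simp only [fun t => T.C₁_eq (hherm (A.setParam θ l m t)) (htr _),
    fun t => T.C₂_eq (hherm (A.setParam θ l m t)) (htr _)]
  obtain ⟨r, hr, hrn⟩ := A.exists_hasDerivAt_pauliVec_noisyState ν hρ₀.1.isHermitian θ m hl
  have hda : ∀ w, HasDerivAt (fun t => 2 ^ n *
      inner ℝ (NoisyVQA.pauliVec (A.noisyState ν ρ₀ (A.setParam θ l m t) L)) w)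
      (2 ^ n * inner ℝ r w) (θ l m) := fun w => by
    have h := (hr.inner ℝ (hasDerivAt_const (θ l m) w)).const_mul (2 ^ n : ℝ)
    simpa using h
  set v := NoisyVQA.pauliVec (A.noisyState ν ρ₀ θ L) with hv
  set a₁ := 2 ^ n * inner ℝ v T.w₁
  set a₂ := 2 ^ n * inner ℝ v T.w₂ with ha₂
  have ha₂0 : a₂ ≠ 0 := by
    rw [NoisyVQA.TruncatedObservable.O₂',
      NoisyVQA.TruncatedObservable.trace_mul_traceless T.isHermitian_O₂
      (hherm θ) (htr θ)] at hC₂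
    exact fun h => hC₂ (by rw [← Complex.ofReal_zero]; exact congrArg _ h)
  have hw₂ : T.w₂ ≠ 0 := fun h => ha₂0 (by rw [ha₂, h, inner_zero_right, mul_zero])
  have hq0 : 0 < ν.strength := lt_of_lt_of_le (by positivity) hεq
  have h2n : (0 : ℝ) < 2 ^ n := by positivity
  have hv_le : 2 ^ n * ‖v‖ ≤ ν.strength ^ L * √(2 ^ n - 1) :=
    calc 2 ^ n * ‖v‖ ≤ 2 ^ n * (ν.strength ^ L * ‖NoisyVQA.pauliVec ρ₀‖) :=
          mul_le_mul_of_nonneg_left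
            (A.norm_pauliVec_noisyState_le ν hρ₀.1.isHermitian θ L) h2n.le
      _ = ν.strength ^ L * (2 ^ n * ‖NoisyVQA.pauliVec ρ₀‖) := by ring
      _ ≤ _ := mul_le_mul_of_nonneg_left hρ₀.norm_pauliVec_le (by positivity)
  set M := √(2 ^ n - 1) * ‖T.w₂‖ with hMdef
  have ha : |a₂| ≤ ν.strength ^ L * M := by
    rw [ha₂, abs_mul, abs_of_pos h2n]
    calc _ ≤ 2 ^ n * (‖v‖ * ‖T.w₂‖) :=
          mul_le_mul_of_nonneg_left (abs_real_inner_le_norm _ _) h2n.le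
      _ = 2 ^ n * ‖v‖ * ‖T.w₂‖ := by ring
      _ ≤ ν.strength ^ L * √(2 ^ n - 1) * ‖T.w₂‖ :=
          mul_le_mul_of_nonneg_right hv_le (norm_nonneg _)
      _ = _ := by ring
  -- A nonzero `a₂` excludes the degenerate cases `n = 0` and `w₂ = 0`.
  have hM : 0 < M := pos_of_mul_pos_right ((abs_pos.mpr ha₂0).trans_le ha) (by positivity)
  have hL₀' : ν.strength ^ L₀ * M * (1 + ε) ≤ |T.k₂| := by
    rw [hMdef, ← mul_assoc]
    exact hL₀.1
  have hden : T.k₂ + a₂ ≠ 0 := by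
    intro h
    have h1 : |T.k₂| = |a₂| := by rw [eq_neg_of_add_eq_zero_left h, abs_neg]
    have h2 : ν.strength ^ L * M ≤ ν.strength ^ L₀ * M :=
      mul_le_mul_of_nonneg_right
        (pow_le_pow_of_le_one hq0.le ν.strength_le_one (by omega)) hM.le
    have h3 : 0 < ν.strength ^ L₀ * M * ε := by positivity
    linarith
  have hself := A.setParam_self θ l m
  have hd₁ := ((hda T.w₁).const_add T.k₁).fun_div ((hda T.w₂).const_add T.k₂)
    (by rw [hself]; exact hden)
  have hd₂ := (hda T.w₁).fun_div (hda T.w₂) (by rw [hself]; exact ha₂0)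
  refine ⟨hd₁.differentiableAt, hd₂.differentiableAt, ?_⟩
  rw [hd₁.deriv, hd₂.deriv, hself, ge_iff_le]
  set W := T.k₂ • T.w₁ - T.k₁ • T.w₂ with hW
  set η := NoisyVQA.pauliVec (A.H l m)
  have hη0 : 0 ≤ NoisyVQA.numNonzero η * NoisyVQA.maxNorm η :=
    mul_nonneg (Nat.cast_nonneg _) (norm_nonneg _)
  -- One `√2` of the commutator factor `2 = √2 * √2` is absorbed in `B`; the other stays in the
  -- bound on `D`.
  have hsqrt : √(2 ^ (n + 1) - 2 : ℝ) = √2 * √(2 ^ n - 1) := by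
    rw [← Real.sqrt_mul zero_le_two]
    congr 1
    ring
  set B := √(2 ^ (n + 1) - 2) * NoisyVQA.numNonzero η * NoisyVQA.maxNorm η * ‖W‖ with hB
  have hB' : B = √2 * √(2 ^ n - 1) * (NoisyVQA.numNonzero η * NoisyVQA.maxNorm η) * ‖W‖ := by
    rw [hB, hsqrt]
    ring
  have hs : T.s ν.strength ε L₀ (A.H l m) = min (ε ^ 2 * T.k₂ ^ 2 / ((1 + ε) ^ 2 * B))
      ((|T.k₂| / (ν.strength ^ L₀ * M) - ν.strength ^ (L₀ + 1)) ^ 2) := by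
    rw [NoisyVQA.TruncatedObservable.s, hB, hMdef]
    simp only [mul_assoc]
    rfl
  have hB0 : 0 ≤ B := by
    rw [hB']
    positivity
  refine NoisyVQA.gradient_bound (D := 2 ^ n * inner ℝ r W) hε ν.strength_le_one hεq hM hL₀'
    (T.abs_k₂_le hw₂) hL ha hB0 ?_ ?_ ?_ (hs.le.trans (min_le_left _ _))
    (hs.le.trans (min_le_right _ _))
  · rw [abs_mul, abs_of_pos h2n]
    calc _ ≤ 2 ^ n * (‖r‖ * ‖W‖) :=
          mul_le_mul_of_nonneg_left (abs_real_inner_le_norm _ _) h2n.le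
      _ ≤ 2 ^ n * ((2 * (NoisyVQA.numNonzero η * NoisyVQA.maxNorm η) *
          (ν.strength ^ L * ‖NoisyVQA.pauliVec ρ₀‖)) * ‖W‖) := by
          gcongr
      _ = 2 * (NoisyVQA.numNonzero η * NoisyVQA.maxNorm η) * ν.strength ^ L * ‖W‖ *
          (2 ^ n * ‖NoisyVQA.pauliVec ρ₀‖) := by
          ring
      _ ≤ 2 * (NoisyVQA.numNonzero η * NoisyVQA.maxNorm η) * ν.strength ^ L * ‖W‖ * √(2 ^ n - 1) :=
          mul_le_mul_of_nonneg_left hρ₀.norm_pauliVec_le (by positivity)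
      _ = (√2 * √2) * (NoisyVQA.numNonzero η * NoisyVQA.maxNorm η) * ν.strength ^ L *
          ‖W‖ * √(2 ^ n - 1) := by
          rw [Real.mul_self_sqrt zero_le_two]
      _ = _ := by rw [hB']; ring
  -- After clearing denominators, the terms in `a₁` and `a₂` agree on both sides, leaving `k₂ ∂a₁ -
  -- k₁ ∂a₂`.
  · change (T.k₂ + a₂) ^ 2 * ((2 ^ n * inner ℝ r T.w₁ * (T.k₂ + a₂) -
      (T.k₁ + a₁) * (2 ^ n * inner ℝ r T.w₂)) / (T.k₂ + a₂) ^ 2) =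
      a₂ ^ 2 * ((2 ^ n * inner ℝ r T.w₁ * a₂ - a₁ * (2 ^ n * inner ℝ r T.w₂)) / a₂ ^ 2) + _
    rw [mul_div_cancel₀ _ (pow_ne_zero 2 hden), mul_div_cancel₀ _ (pow_ne_zero 2 ha₂0), hW,
      inner_sub_right, real_inner_smul_right, real_inner_smul_right]
    ring
  · rw [hs]
    positivity
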